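/- Let $n\ge 0$ and $a\ge 1$ be integers and let $[n]=\{0,\dots,n-1\}$ index $n$ qudits of local dimension $a$. Let $\mathcal C\subseteq(\mathbb C^a)^{\otimes n}$ be a quantum code of dimension $k>0$, i.e. a linear subspace with $\dim_{\mathbb C}\mathcal C=a^k$ ($k$ real). For a code state, i.e. a unit vector $|\psi\rangle\in\mathcal C$, write $\psi=|\psi\rangle\langle\psi|$, and for $B\subseteq[n]$ write $\psi_B=\operatorname{Tr}_{[n]\setminus B}\psi$. Call a set $I\subseteq[n]$ with $i\in I$ a recovery set for qudit $i$ if there is a quantum channel (a completely positive, trace preserving linear map) $\operatorname{Rec}$ from operators on the qudits $I\setminus\{i\}$ to operators on the qudits $I$ such that $$(\operatorname{Rec}\otimes \mathrm{id}_{[n]\setminus I})(\psi_{[n]\setminus\{i\}})=\psi\qquad\text{for every code state }\psi\text{ of }\mathcal C .$$ 1. Suppose that some $i\in[n]$ has two recovery sets $I^1,I^2$ with $I^1\cap I^2=\{i\}$. Then there is a one-qudit density matrix $\alpha$ (independent of $\psi$) such that $\psi=\alpha_i\otimes\psi_{[n]\setminus\{i\}}$ for every code state $\psi$ of $\mathcal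 C$, where $\alpha_i$ denotes $\alpha$ placed on qudit $i$. 2. In particular, quantum locally correctable codes are impossible, even in the weakest sense: if $a\ge 2$, it cannot be the case that every qudit $i\in[n]$ has two recovery sets $I^1_i,I^2_i$ with $I^1_i\cap I^2_i=\{i\}$. -/

import Mathlib

namespace Qudit

open scoped ComplexOrder

/-- The Hilbert space `(ℂ^a)^{⊗A}` of a finite set `A` of qudits of local dimension `a`, in
coordinates with respect to the computational basis `|x⟩`, `x : A → Fin a`. -/
abbrev Space (a : ℕ) (A : Type) : Type := EuclideanSpace ℂ (A → Fin a)

/-- Linear operators on `(ℂ^a)^{⊗A}`, as matrices in the computational basis. -/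
abbrev Op (a : ℕ) (A : Type) : Type := Matrix (A → Fin a) (A → Fin a) ℂ

/-- Density matrices: positive semidefinite operators of trace one. -/
def IsDensityMatrix {X : Type} [Fintype X] (ρ : Matrix X X ℂ) : Prop :=
  ρ.PosSemidef ∧ ρ.trace = 1

/-- The operator `|ψ⟩⟨ψ|`. -/
def pureState {a : ℕ} {A : Type} (ψ : Space a A) : Op a A :=
  Matrix.of fun x y => ψ x * star (ψ y)

/-- `K ⊗ id_Z`, for a linear map `K` on operators and an ancilla with basis indexed by `Z`:
`K` is applied to each block `⟨z| X |z'⟩`. -/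
def ampliate {X Y : Type} (K : Matrix X X ℂ →ₗ[ℂ] Matrix Y Y ℂ) (Z : Type)
    (M : Matrix (X × Z) (X × Z) ℂ) : Matrix (Y × Z) (Y × Z) ℂ :=
  Matrix.of fun p q => K (Matrix.of fun x x' => M (x, p.2) (x', q.2)) p.1 q.1

/-- Complete positivity: `K ⊗ id` preserves positive semidefiniteness for each ancilla `ℂ^m`. -/
def IsCompletelyPositive {X Y : Type} (K : Matrix X X ℂ →ₗ[ℂ] Matrix Y Y ℂ) : Prop :=
  ∀ (m : ℕ) (M : Matrix (X × Fin m) (X × Fin m) ℂ),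
    M.PosSemidef → (ampliate K (Fin m) M).PosSemidef

/-- Quantum channels: completely positive, trace preserving linear maps. -/
structure IsChannel {X Y : Type} [Fintype X] [Fintype Y]
    (K : Matrix X X ℂ →ₗ[ℂ] Matrix Y Y ℂ) : Prop where
  completelyPositive : IsCompletelyPositive K
  tracePreserving : ∀ M, (K M).trace = M.trace

variable {n a : ℕ}

/-- The basis label on `[n]` that equals `x` on `B` and `z` on `[n] ∖ B`. -/
def glue (B : Finset (Fin n)) (x : ↥B → Fin a) (z : ↥Bᶜ → Fin a) : Fin n → Fin a :=
  fun j => if h : j ∈ B then x ⟨j, h⟩ else z ⟨j, Finset.mem_compl.2 h⟩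

/-- The reduced operator `ρ_B = Tr_{[n] ∖ B} ρ`. -/
def reduced (ρ : Op a (Fin n)) (B : Finset (Fin n)) : Op a ↥B :=
  Matrix.of fun x x' => ∑ z : ↥Bᶜ → Fin a, ρ (glue B x z) (glue B x' z)

/-- The operator `α_i ⊗ σ` on `[n]`, with `α` placed on qudit `i` and `σ` on `[n] ∖ {i}`. -/
def tensorAt (i : Fin n) (α : Matrix (Fin a) (Fin a) ℂ) (σ : Op a ↥({i}ᶜ : Finset (Fin n))) :
    Op a (Fin n) :=
  Matrix.of fun u u' => α (u i) (u' i) * σ (fun j => u j) (fun j => u' j)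

/-- For `i ∈ I`: the basis label on `[n] ∖ {i}` that equals `x` on `I ∖ {i}` and agrees with `u` on
`[n] ∖ I`. -/
def overwrite (i : Fin n) (I : Finset (Fin n)) (x : ↥(I.erase i) → Fin a) (u : Fin n → Fin a) :
    ↥({i}ᶜ : Finset (Fin n)) → Fin a :=
  fun j => if h : j.1 ∈ I then
      x ⟨j.1, Finset.mem_erase.2 ⟨fun e => Finset.mem_compl.1 j.2 (Finset.mem_singleton.2 e), h⟩⟩
    else u j

/-- For `i ∈ I` and a linear map `K` from operators on `I ∖ {i}` to operators on `I`, the map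
`K ⊗ id_{[n] ∖ I}` from operators on `[n] ∖ {i}` to operators on `[n]`. -/
def applyLocal (i : Fin n) (I : Finset (Fin n)) (K : Op a ↥(I.erase i) →ₗ[ℂ] Op a ↥I)
    (ρ : Op a ↥({i}ᶜ : Finset (Fin n))) : Op a (Fin n) :=
  Matrix.of fun u u' =>
    K (Matrix.of fun x x' => ρ (overwrite i I x u) (overwrite i I x' u'))
      (fun j => u j) (fun j => u' j)

/-- A quantum code of block length `n` and local dimension `a` is a linear subspace of
`(ℂ^a)^{⊗n}`; its dimension is `k` if, as a vector space, it is `a^k`-dimensional. -/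
def HasCodeDimension (C : Submodule ℂ (Space a (Fin n))) (k : ℝ) : Prop :=
  (Module.finrank ℂ C : ℝ) = (a : ℝ) ^ k

/-- `I ∋ i` is a recovery set for qudit `i` of the code `C`: some channel from the qudits
`I ∖ {i}` to the qudits `I` restores each code state after the erasure of qudit `i`. -/
def IsRecoverySet (C : Submodule ℂ (Space a (Fin n))) (i : Fin n) (I : Finset (Fin n)) : Prop :=
  i ∈ I ∧ ∃ Rec : Op a ↥(I.erase i) →ₗ[ℂ] Op a ↥I, IsChannel Rec ∧
    ∀ ψ ∈ C, ‖ψ‖ = 1 → applyLocal i I Rec (reduced (pureState ψ) {i}ᶜ) = pureState ψ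

end Qudit

namespace Qudit

/-! ### Linear maps on matrices, and no cloning -/

open scoped ComplexOrder

/-! The argument is no cloning. Suppose qudit `i` can be rebuilt both from `A = I₁ \ {i}` and from
the disjoint `B = I₂ \ {i}`. Applying the second recovery while the original qudit is still present
yields a positive operator; tracing out the original qudit leaves the pure state, so the original
qudit splits off as a factor `α` (`exists_eq_mul_of_partialTrace_pure`). The first recovery acts on
`A`, so it commutes with the second; used to rewrite the original state, it shows that this `α` is
already the factor of qudit `i` in that state (`exists_eq_mul_sum_of_recovery`).

To get one `α` for all code states, the argument is run on the code entangled with a reference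
system indexed by a basis, after polarizing the recovery identity to operators `|ψ⟩⟨φ|`. Each code
state is then `f (u i)` times a function not depending on `u i`. If this holds at every `i`, the
code is at most one-dimensional, whereas `a ^ k > 1`. -/

theorem linearMap_apply_eq_sum {X Y : Type} [Fintype X]
    (K : Matrix X X ℂ →ₗ[ℂ] Matrix Y Y ℂ) (y y' : Y) :
    ∃ c : X → X → ℂ, ∀ M : Matrix X X ℂ, K M y y' = ∑ s, ∑ s', M s s' * c s s' := by
  classical
  refine ⟨fun s s' => K (Matrix.single s s' 1) y y', fun M => ?_⟩
  conv_lhs => rw [Matrix.matrix_eq_sum_single M]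
  simp only [map_sum, Matrix.sum_apply]
  refine Finset.sum_congr rfl fun s _ => Finset.sum_congr rfl fun s' _ => ?_
  have : Matrix.single s s' (M s s') = M s s' • Matrix.single s s' (1 : ℂ) := by
    simp [Matrix.smul_single]
  rw [this, map_smul]
  simp

/-- Maps on different tensor factors commute: expanded in matrix entries, this is an interchange of
finite sums. -/
theorem linearMap_apply_comm {A B A₁ B₁ : Type} [Fintype A] [Fintype B]
    (K₁ : Matrix A A ℂ →ₗ[ℂ] Matrix A₁ A₁ ℂ) (K₂ : Matrix B B ℂ →ₗ[ℂ] Matrix B₁ B₁ ℂ)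
    (T : A → A → B → B → ℂ) (a a' : A₁) (b b' : B₁) :
    K₁ (Matrix.of fun s s' => K₂ (Matrix.of fun t t' => T s s' t t') b b') a a' =
      K₂ (Matrix.of fun t t' => K₁ (Matrix.of fun s s' => T s s' t t') a a') b b' := by
  obtain ⟨c, hc⟩ := linearMap_apply_eq_sum K₁ a a'
  obtain ⟨d, hd⟩ := linearMap_apply_eq_sum K₂ b b'
  simp only [hc, hd, Matrix.of_apply, Finset.sum_mul]
  calc _ = ∑ s, ∑ t, ∑ s', ∑ t', T s s' t t' * d t t' * c s s' :=
        Finset.sum_congr rfl fun s _ => Finset.sum_comm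
    _ = ∑ t, ∑ s, ∑ t', ∑ s', T s s' t t' * d t t' * c s s' := by
        rw [Finset.sum_comm]
        exact Finset.sum_congr rfl fun t _ => Finset.sum_congr rfl fun s _ => Finset.sum_comm
    _ = ∑ t, ∑ t', ∑ s, ∑ s', T s s' t t' * d t t' * c s s' :=
        Finset.sum_congr rfl fun t _ => Finset.sum_comm
    _ = _ := by simp only [mul_right_comm]

theorem IsCompletelyPositive.ampliate_posSemidef {X Y Z : Type} [Fintype Z]
    {K : Matrix X X ℂ →ₗ[ℂ] Matrix Y Y ℂ} (hK : IsCompletelyPositive K)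
    {M : Matrix (X × Z) (X × Z) ℂ} (hM : M.PosSemidef) : (ampliate K Z M).PosSemidef := by
  let e := Fintype.equivFin Z
  have h := (hK _ _ (hM.submatrix (fun p : X × Fin (Fintype.card Z) => (p.1, e.symm p.2)))).submatrix
    (fun p : Y × Z => (p.1, e p.2))
  convert h using 1
  ext p q
  simp [ampliate]

open scoped MatrixOrder Matrix.Norms.L2Operator in
theorem exists_eq_conjTranspose_mul_self {X : Type} [Fintype X] {M : Matrix X X ℂ}
    (hM : M.PosSemidef) : ∃ D : Matrix X X ℂ, M = D.conjTranspose * D := by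
  classical
  exact CStarAlgebra.nonneg_iff_eq_star_mul_self.1 hM.nonneg

/-- A positive semidefinite operator whose partial trace is pure is a product. -/
theorem exists_eq_mul_of_partialTrace_pure {Q Y : Type} [Fintype Q] [Fintype Y]
    {ω : Matrix (Q × Y) (Q × Y) ℂ} (hω : ω.PosSemidef) {v : Y → ℂ}
    (hv : ∀ y y', ∑ q, ω (q, y) (q, y') = v y * star (v y')) :
    ∃ α : Q → Q → ℂ, ∀ q y q' y', ω (q, y) (q', y') = α q q' * (v y * star (v y')) := by
  classical
  obtain ⟨D, rfl⟩ := exists_eq_conjTranspose_mul_self hω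
  simp only [Matrix.mul_apply, Matrix.conjTranspose_apply] at hv ⊢
  -- The columns of `D` at `(q, y)` are proportional to `star (v y)`: the squared norms of the
  -- defects `t`, summed over `q`, expand into four partial traces that cancel.
  have key : ∀ y y₀ q m, star (v y₀) * D m (q, y) = star (v y) * D m (q, y₀) := by
    intro y y₀
    let t : Q → (Q × Y) → ℂ := fun q m => star (v y₀) * D m (q, y) - star (v y) * D m (q, y₀)
    have h0 : ∑ q, ∑ m, star (t q m) * t q m = 0 := by
      have : ∑ q, ∑ m, star (t q m) * t q m =
          v y₀ * star (v y₀) * (∑ q, ∑ m, star (D m (q, y)) * D m (q, y))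
          - v y₀ * star (v y) * (∑ q, ∑ m, star (D m (q, y)) * D m (q, y₀))
          - v y * star (v y₀) * (∑ q, ∑ m, star (D m (q, y₀)) * D m (q, y))
          + v y * star (v y) * (∑ q, ∑ m, star (D m (q, y₀)) * D m (q, y₀)) := by
        simp only [Finset.mul_sum, ← Finset.sum_sub_distrib, ← Finset.sum_add_distrib]
        refine Finset.sum_congr rfl fun q _ => Finset.sum_congr rfl fun m _ => ?_
        simp only [t, star_sub, star_mul', star_star]
        ring
      rw [this]
      simp only [hv]
      ring
    intro q m
    have h1 := (Finset.sum_eq_zero_iff_of_nonneg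
      (fun q _ => Finset.sum_nonneg fun m _ => star_mul_self_nonneg (t q m))).1 h0 q
      (Finset.mem_univ q)
    have h2 := (Finset.sum_eq_zero_iff_of_nonneg
      (fun m _ => star_mul_self_nonneg (t q m))).1 h1 m (Finset.mem_univ m)
    have h3 : t q m = 0 := by simpa using h2
    exact sub_eq_zero.1 h3
  by_cases h : ∃ y₀, v y₀ ≠ 0
  · obtain ⟨y₀, hy₀⟩ := h
    have hs : star (v y₀) ≠ 0 := star_ne_zero.2 hy₀
    refine ⟨fun q q' => (∑ m, star (D m (q, y₀)) * D m (q', y₀)) / (v y₀ * star (v y₀)),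
      fun q y q' y' => ?_⟩
    have hD : ∀ q y m, D m (q, y) = star (v y) * D m (q, y₀) / star (v y₀) := fun q y m => by
      rw [eq_div_iff hs, ← key, mul_comm]
    simp only [Finset.sum_div, Finset.sum_mul]
    refine Finset.sum_congr rfl fun m _ => ?_
    rw [hD q y, hD q' y']
    simp only [star_div₀, star_mul', star_star]
    field_simp
  · push Not at h
    refine ⟨0, fun q y q' y' => ?_⟩
    have h0 : ∑ q, ∑ m, star (D m (q, y)) * D m (q, y) = 0 := by
      simp only [hv, h, zero_mul]
    have h1 := (Finset.sum_eq_zero_iff_of_nonneg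
      (fun q _ => Finset.sum_nonneg fun m _ => star_mul_self_nonneg (D m (q, y)))).1 h0 q
      (Finset.mem_univ q)
    have h2 := (Finset.sum_eq_zero_iff_of_nonneg
      (fun m _ => star_mul_self_nonneg (D m (q, y)))).1 h1
    simp only [Pi.zero_apply, zero_mul]
    refine Finset.sum_eq_zero fun m hm => ?_
    have h3 : D m (q, y) = 0 := by simpa using h2 m hm
    simp [h3]

/-- No cloning: a pure state whose part `P` can be recovered both from `A` and from `B` is a
product of `P` and the rest. -/
theorem exists_eq_mul_sum_of_recovery {P A B E A₁ B₁ : Type}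
    [Fintype P] [Fintype A] [Fintype B] [Fintype E] {Ψ : P → A → B → E → ℂ}
    {K₁ : Matrix A A ℂ →ₗ[ℂ] Matrix A₁ A₁ ℂ} {K₂ : Matrix B B ℂ →ₗ[ℂ] Matrix B₁ B₁ ℂ}
    (hK₂ : IsCompletelyPositive K₂) (j₁ : P → A → A₁) (j₂ : P → B → B₁)
    (h₁ : ∀ p x y z p' x' y' z',
      K₁ (Matrix.of fun s s' => ∑ q, Ψ q s y z * star (Ψ q s' y' z')) (j₁ p x) (j₁ p' x') =
        Ψ p x y z * star (Ψ p' x' y' z'))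
    (h₂ : ∀ p x y z p' x' y' z',
      K₂ (Matrix.of fun t t' => ∑ q, Ψ q x t z * star (Ψ q x' t' z')) (j₂ p y) (j₂ p' y') =
        Ψ p x y z * star (Ψ p' x' y' z')) :
    ∃ α : P → P → ℂ, ∀ p x y z p' x' y' z',
      Ψ p x y z * star (Ψ p' x' y' z') = α p p' * ∑ q, Ψ q x y z * star (Ψ q x' y' z') := by
  classical
  let M : Matrix (B × (P × A × E)) (B × (P × A × E)) ℂ :=
    Matrix.vecMulVec (fun s => Ψ s.2.1 s.2.2.1 s.1 s.2.2.2)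
      (star fun s => Ψ s.2.1 s.2.2.1 s.1 s.2.2.2)
  have hM : M.PosSemidef := Matrix.posSemidef_vecMulVec_self_star _
  -- Two copies of `P` now coexist: `s.1` is the original, `s.2.1` is the one produced by `K₂`.
  have hω := (hK₂.ampliate_posSemidef hM).submatrix
    (fun s : P × (P × A × B × E) => (j₂ s.2.1 s.2.2.2.1, (s.1, s.2.2.1, s.2.2.2.2)))
  obtain ⟨α, hα⟩ := exists_eq_mul_of_partialTrace_pure hω
    (v := fun s => Ψ s.1 s.2.1 s.2.2.1 s.2.2.2) (by
      rintro ⟨p, x, y, z⟩ ⟨p', x', y', z'⟩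
      simp only [Matrix.submatrix_apply, ampliate, Matrix.of_apply, M,
        Matrix.vecMulVec_apply, Pi.star_apply]
      rw [← h₂ p x y z p' x' y' z']
      obtain ⟨c, hc⟩ := linearMap_apply_eq_sum K₂ (j₂ p y) (j₂ p' y')
      simp only [hc, Matrix.of_apply, Finset.sum_mul]
      rw [Finset.sum_comm]
      exact Finset.sum_congr rfl fun t _ => Finset.sum_comm)
  refine ⟨α, fun p x y z p' x' y' z' => ?_⟩
  have hα' : ∀ q, K₂ (Matrix.of fun t t' => Ψ p x t z * star (Ψ p' x' t' z')) (j₂ q y) (j₂ q y') =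
      α p p' * (Ψ q x y z * star (Ψ q x' y' z')) :=
    fun q => hα p (q, x, y, z) p' (q, x', y', z')
  rw [Finset.mul_sum]
  -- The sum over `q` traces out the copy produced by `K₂`. Writing the input as an output of `K₁`
  -- and commuting lets `h₂` remove `K₂`; then `h₁` removes `K₁`.
  have hK₁ : (fun t t' => Ψ p x t z * star (Ψ p' x' t' z')) = fun t t' =>
      K₁ (Matrix.of fun s s' => ∑ q, Ψ q s t z * star (Ψ q s' t' z')) (j₁ p x) (j₁ p' x') := by
    funext t t'
    rw [h₁]
  simp only [← hα', hK₁, ← linearMap_apply_comm, h₂]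
  rw [← h₁ p x y z p' x' y' z']
  obtain ⟨c, hc⟩ := linearMap_apply_eq_sum K₁ (j₁ p x) (j₁ p' x')
  simp only [hc, Matrix.of_apply, Finset.sum_mul]
  symm
  rw [Finset.sum_comm]
  exact Finset.sum_congr rfl fun t _ => Finset.sum_comm

/-! ### Basis labels, and polarization of the recovery identity -/

variable {n a : ℕ}

/-- The basis label that equals `x` on `I` and agrees with `u` elsewhere. -/
def fill (I : Finset (Fin n)) (x : ↥I → Fin a) (u : Fin n → Fin a) : Fin n → Fin a :=
  fun j => if h : j ∈ I then x ⟨j, h⟩ else u j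

theorem reduced_compl_singleton (ρ : Op a (Fin n)) (i : Fin n)
    (w w' : ↥({i}ᶜ : Finset (Fin n)) → Fin a) :
    reduced ρ {i}ᶜ w w' = ∑ q, ρ (glue {i}ᶜ w fun _ => q) (glue {i}ᶜ w' fun _ => q) := by
  have hi : i ∈ ({i}ᶜᶜ : Finset (Fin n)) := by simp
  have : Unique ↥({i}ᶜᶜ : Finset (Fin n)) :=
    ⟨⟨⟨i, hi⟩⟩, fun j => Subtype.ext (by simpa using j.2)⟩
  refine Fintype.sum_equiv (Equiv.funUnique _ (Fin a)) _ _ fun z => ?_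
  have hz : z = fun _ => Equiv.funUnique _ (Fin a) z :=
    ((Equiv.funUnique _ (Fin a)).symm_apply_apply z).symm
  rw [← hz]

theorem glue_compl_singleton (i : Fin n) (u : Fin n → Fin a) (q : Fin a) :
    glue {i}ᶜ (fun j => u j) (fun _ => q) = Function.update u i q := by
  ext j
  by_cases h : j = i
  · subst h; simp [glue]
  · simp [glue, h]

theorem overwrite_eq_fill (i : Fin n) (I : Finset (Fin n)) (x : ↥(I.erase i) → Fin a)
    (u : Fin n → Fin a) :
    overwrite i I x u = fun j : ↥({i}ᶜ : Finset (Fin n)) => fill (I.erase i) x u j := by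
  funext ⟨j, hj⟩
  have : j ≠ i := by simpa using hj
  by_cases h : j ∈ I <;> simp [overwrite, fill, h, this]

theorem applyLocal_reduced (i : Fin n) (I : Finset (Fin n))
    (K : Op a ↥(I.erase i) →ₗ[ℂ] Op a ↥I) (ψ : Space a (Fin n)) (u u' : Fin n → Fin a) :
    applyLocal i I K (reduced (pureState ψ) {i}ᶜ) u u' =
      K (Matrix.of fun x x' => ∑ q, ψ (Function.update (fill (I.erase i) x u) i q) *
        star (ψ (Function.update (fill (I.erase i) x' u') i q))) (fun j => u j) (fun j => u' j) := by
  simp only [applyLocal, Matrix.of_apply, reduced_compl_singleton, overwrite_eq_fill,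
    glue_compl_singleton, pureState]

/-- A sesquilinear form that vanishes on the unit vectors of a subspace vanishes on the subspace. -/
theorem sesquilinear_eq_zero {V : Type} [NormedAddCommGroup V] [NormedSpace ℂ V]
    (C : Submodule ℂ V) (B : V → V → ℂ)
    (add_left : ∀ x y z, B (x + y) z = B x z + B y z)
    (add_right : ∀ x y z, B x (y + z) = B x y + B x z)
    (smul_left : ∀ (c : ℂ) x y, B (c • x) y = c * B x y)
    (smul_right : ∀ (c : ℂ) x y, B x (c • y) = star c * B x y)
    (hB : ∀ x ∈ C, ‖x‖ = 1 → B x x = 0) {x y : V} (hx : x ∈ C) (hy : y ∈ C) : B x y = 0 := by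
  have h : ∀ x ∈ C, B x x = 0 := by
    intro x hx
    by_cases h0 : x = 0
    · have := smul_left 0 x x
      rw [zero_smul, zero_mul] at this
      rwa [h0] at this ⊢
    · have hn : ‖x‖ ≠ 0 := norm_ne_zero_iff.2 h0
      have h1 := hB (((‖x‖⁻¹ : ℝ) : ℂ) • x) (C.smul_mem _ hx) (by
        rw [norm_smul, Complex.norm_real, norm_inv, norm_norm, inv_mul_cancel₀ hn])
      rw [smul_left, smul_right] at h1
      simpa [hn, h0] using h1
  -- Polarization with `x + y` and `x + i y`.
  have h1 := h _ (C.add_mem hx hy)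
  have h2 := h _ (C.add_mem hx (C.smul_mem Complex.I hy))
  simp only [add_left, add_right, smul_left, smul_right, h x hx, h y hy] at h1 h2
  have hs : star Complex.I = -Complex.I := Complex.conj_I
  rw [hs] at h2
  have h3 : Complex.I * (B y x - B x y) = 0 := by linear_combination h2
  have h4 := (mul_eq_zero.1 h3).resolve_left Complex.I_ne_zero
  linear_combination (h1 - h4) / 2

/-- The recovery map restores the operators `|ψ⟩⟨φ|`, for `ψ` and `φ` in the code. -/
theorem recovery_polarized {C : Submodule ℂ (Space a (Fin n))} {i : Fin n} {I : Finset (Fin n)}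
    {K : Op a ↥(I.erase i) →ₗ[ℂ] Op a ↥I}
    (hK : ∀ ψ ∈ C, ‖ψ‖ = 1 → applyLocal i I K (reduced (pureState ψ) {i}ᶜ) = pureState ψ)
    {ψ φ : Space a (Fin n)} (hψ : ψ ∈ C) (hφ : φ ∈ C) (u u' : Fin n → Fin a) :
    K (Matrix.of fun x x' => ∑ q, ψ (Function.update (fill (I.erase i) x u) i q) *
        star (φ (Function.update (fill (I.erase i) x' u') i q))) (fun j => u j) (fun j => u' j) =
      ψ u * star (φ u') := by
  obtain ⟨c, hc⟩ := linearMap_apply_eq_sum K (fun j => u j) (fun j => u' j)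
  rw [← sub_eq_zero, hc]
  refine sesquilinear_eq_zero C (fun ψ φ : Space a (Fin n) => ∑ x, ∑ x', Matrix.of (fun x x' =>
    ∑ q, ψ (Function.update (fill (I.erase i) x u) i q) *
      star (φ (Function.update (fill (I.erase i) x' u') i q))) x x' * c x x' -
    ψ u * star (φ u')) ?_ ?_ ?_ ?_ ?_ hψ hφ
  · intro x y z
    simp only [Matrix.of_apply, PiLp.add_apply, add_mul, Finset.sum_add_distrib]
    ring
  · intro x y z
    simp only [Matrix.of_apply, PiLp.add_apply, star_add, mul_add, add_mul, Finset.sum_add_distrib]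
    ring
  · intro d x y
    simp only [Matrix.of_apply, PiLp.smul_apply, smul_eq_mul, mul_sub, Finset.mul_sum,
      Finset.sum_mul, mul_assoc]
  · intro d x y
    simp only [Matrix.of_apply, PiLp.smul_apply, smul_eq_mul, mul_sub, Finset.mul_sum,
      Finset.sum_mul, mul_assoc, star_mul', mul_left_comm _ (star d)]
  · intro ψ hψ h1
    rw [← hc, ← applyLocal_reduced, hK ψ hψ h1]
    simp [pureState]

theorem fill_restrict (I : Finset (Fin n)) (u : Fin n → Fin a) : fill I (fun j => u j) u = u := by
  ext j
  simp [fill]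

/-- The label on `I` equal to `p` at `i` and to `x` on the rest of `I`. -/
def extendAt (i : Fin n) (I : Finset (Fin n)) (p : Fin a) (x : ↥(I.erase i) → Fin a) :
    ↥I → Fin a :=
  fun j => if h : j.1 = i then p else x ⟨j, Finset.mem_erase.2 ⟨h, j.2⟩⟩

theorem update_fill_restrict (i : Fin n) (I : Finset (Fin n)) (p : Fin a)
    (x : ↥(I.erase i) → Fin a) (u : Fin n → Fin a) :
    (fun j : ↥I => Function.update (fill (I.erase i) x u) i p j) = extendAt i I p x := by
  funext ⟨j, hj⟩
  by_cases h : j = i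
  · subst h; simp [extendAt]
  · simp [extendAt, fill, h, hj]

theorem update_fill_update_fill (i : Fin n) (I : Finset (Fin n)) (p q : Fin a)
    (x x' : ↥(I.erase i) → Fin a) (u : Fin n → Fin a) :
    Function.update (fill (I.erase i) x' (Function.update (fill (I.erase i) x u) i p)) i q =
      Function.update (fill (I.erase i) x' u) i q := by
  ext j
  by_cases h : j = i
  · subst h; simp
  · by_cases hj : j ∈ I <;> simp [fill, h, hj]

theorem fill_comm {I J : Finset (Fin n)} (h : Disjoint I J) (x : ↥I → Fin a) (y : ↥J → Fin a)
    (u : Fin n → Fin a) : fill I x (fill J y u) = fill J y (fill I x u) := by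
  ext j
  by_cases hI : j ∈ I
  · simp [fill, hI, Finset.disjoint_left.1 h hI]
  · simp [fill, hI]

/-- `recovery_polarized` in split coordinates. -/
theorem recovery_polarized_split {C : Submodule ℂ (Space a (Fin n))} {i : Fin n}
    {I : Finset (Fin n)} {K : Op a ↥(I.erase i) →ₗ[ℂ] Op a ↥I}
    (hK : ∀ ψ ∈ C, ‖ψ‖ = 1 → applyLocal i I K (reduced (pureState ψ) {i}ᶜ) = pureState ψ)
    {ψ φ : Space a (Fin n)} (hψ : ψ ∈ C) (hφ : φ ∈ C) (u u' : Fin n → Fin a) (p p' : Fin a)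
    (x x' : ↥(I.erase i) → Fin a) :
    K (Matrix.of fun s s' => ∑ q, ψ (Function.update (fill (I.erase i) s u) i q) *
        star (φ (Function.update (fill (I.erase i) s' u') i q)))
        (extendAt i I p x) (extendAt i I p' x') =
      ψ (Function.update (fill (I.erase i) x u) i p) *
        star (φ (Function.update (fill (I.erase i) x' u') i p')) := by
  have h := recovery_polarized hK hψ hφ (Function.update (fill (I.erase i) x u) i p)
    (Function.update (fill (I.erase i) x' u') i p')
  simpa only [update_fill_update_fill, update_fill_restrict] using h

/-! ### Consequences for codes -/

/-- If qudit `i` has two recovery sets that meet in `{i}`, then it carries the same pure state in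
every code state, unentangled with the other qudits. -/
theorem exists_factor_of_recovery {C : Submodule ℂ (Space a (Fin n))} (hC : C ≠ ⊥) {i : Fin n}
    {I₁ I₂ : Finset (Fin n)} (hI : I₁ ∩ I₂ = {i}) (h₁ : IsRecoverySet C i I₁)
    (h₂ : IsRecoverySet C i I₂) :
    ∃ f : Fin a → ℂ, f ≠ 0 ∧ ∀ ψ ∈ C, ∃ g : (Fin n → Fin a) → ℂ,
      (∀ u p, g (Function.update u i p) = g u) ∧ ∀ u, ψ u = f (u i) * g u := by
  classical
  obtain ⟨-, K₁, -, hK₁⟩ := h₁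
  obtain ⟨-, K₂, ⟨hcp, -⟩, hK₂⟩ := h₂
  have hdisj : Disjoint (I₁.erase i) (I₂.erase i) := by
    rw [Finset.disjoint_left]
    intro j hj₁ hj₂
    simp only [Finset.mem_erase] at hj₁ hj₂
    have : j ∈ I₁ ∩ I₂ := Finset.mem_inter.2 ⟨hj₁.2, hj₂.2⟩
    rw [hI, Finset.mem_singleton] at this
    exact hj₁.1 this
  let b := Module.finBasis ℂ C
  -- The environment holds a basis index of the code (the reference system) and a full label, of
  -- which only the entries outside `I₁ ∪ I₂` matter; this repetition is harmless, as no
  -- normalization is needed.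
  let Ψ : Fin a → (↥(I₁.erase i) → Fin a) → (↥(I₂.erase i) → Fin a) →
      (Fin n → Fin a) × Fin (Module.finrank ℂ C) → ℂ := fun p x y z =>
    (b z.2 : Space a (Fin n))
      (Function.update (fill (I₁.erase i) x (fill (I₂.erase i) y z.1)) i p)
  obtain ⟨α, hα⟩ := exists_eq_mul_sum_of_recovery (Ψ := Ψ) hcp (extendAt i I₁) (extendAt i I₂)
    (fun p x y z p' x' y' z' => recovery_polarized_split hK₁ (b z.2).2 (b z'.2).2 _ _ _ _ _ _)
    (fun p x y z p' x' y' z' => by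
      simp only [Ψ, fill_comm hdisj]
      exact recovery_polarized_split hK₂ (b z.2).2 (b z'.2).2 _ _ _ _ _ _)
  have hb : ∀ r s u u', (b r : Space a (Fin n)) u * star ((b s : Space a (Fin n)) u') =
      α (u i) (u' i) * ∑ q, (b r : Space a (Fin n)) (Function.update u i q) *
        star ((b s : Space a (Fin n)) (Function.update u' i q)) := by
    intro r s u u'
    have := hα (u i) (fun j => u j) (fun j => u j) (u, r) (u' i) (fun j => u' j) (fun j => u' j)
      (u', s)
    simpa only [Ψ, fill_restrict, Function.update_eq_self] using this
  have hpos : 0 < Module.finrank ℂ C := by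
    have := Submodule.nontrivial_iff_ne_bot.2 hC
    exact Module.finrank_pos
  let s : Fin (Module.finrank ℂ C) := ⟨0, hpos⟩
  obtain ⟨u₀, hu₀⟩ : ∃ u, (b s : Space a (Fin n)) u ≠ 0 := by
    by_contra! h
    exact b.ne_zero s (Subtype.ext (PiLp.ext h))
  have hs := star_ne_zero.2 hu₀
  -- Fixing the second argument of `hb` at a nonzero entry of one basis vector turns a column of `α`
  -- into the common factor.
  refine ⟨fun p => α p (u₀ i), fun hf => ?_, fun ψ hψ => ?_⟩
  · have := hb s s u₀ u₀
    rw [show α (u₀ i) (u₀ i) = 0 from congrFun hf (u₀ i), zero_mul] at this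
    exact mul_ne_zero hu₀ hs this
  · refine ⟨fun u => ∑ r, b.repr ⟨ψ, hψ⟩ r * ((∑ q, (b r : Space a (Fin n))
      (Function.update u i q) * star ((b s : Space a (Fin n)) (Function.update u₀ i q))) /
        star ((b s : Space a (Fin n)) u₀)), fun u p => by simp, fun u => ?_⟩
    have h1 := congrArg (fun χ : C => (χ : Space a (Fin n)) u) (b.sum_repr ⟨ψ, hψ⟩)
    simp only [Submodule.coe_sum, Submodule.coe_smul, WithLp.ofLp_sum, Finset.sum_apply,
      PiLp.smul_apply, smul_eq_mul] at h1
    rw [← h1, Finset.mul_sum]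
    refine Finset.sum_congr rfl fun r _ => ?_
    rw [mul_left_comm, ← mul_div_assoc, ← hb, mul_div_cancel_right₀ _ hs]

theorem exists_densityMatrix_of_factor {C : Submodule ℂ (Space a (Fin n))} {i : Fin n}
    {f : Fin a → ℂ} (hf : f ≠ 0) (hC : ∀ ψ ∈ C, ∃ g : (Fin n → Fin a) → ℂ,
      (∀ u p, g (Function.update u i p) = g u) ∧ ∀ u, ψ u = f (u i) * g u) :
    ∃ α : Matrix (Fin a) (Fin a) ℂ, IsDensityMatrix α ∧
      ∀ ψ ∈ C, pureState ψ = tensorAt i α (reduced (pureState ψ) {i}ᶜ) := by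
  have hN : 0 < ∑ q, f q * star (f q) := by
    obtain ⟨p, hp⟩ := Function.ne_iff.1 hf
    exact Finset.sum_pos' (fun q _ => mul_star_self_nonneg _) ⟨p, Finset.mem_univ p,
      lt_of_le_of_ne (mul_star_self_nonneg _) (mul_ne_zero hp (star_ne_zero.2 hp)).symm⟩
  refine ⟨(∑ q, f q * star (f q))⁻¹ • Matrix.vecMulVec f (star f),
    ⟨(Matrix.posSemidef_vecMulVec_self_star f).smul (inv_nonneg.2 hN.le), ?_⟩, fun ψ hψ => ?_⟩
  · rw [Matrix.trace_smul, Matrix.trace, smul_eq_mul]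
    simp only [Matrix.diag_apply, Matrix.vecMulVec_apply, Pi.star_apply]
    exact inv_mul_cancel₀ hN.ne'
  · obtain ⟨g, hg, hψg⟩ := hC ψ hψ
    ext u u'
    have h : ∑ q, f q * g u * (star (f q) * star (g u')) =
        (∑ q, f q * star (f q)) * (g u * star (g u')) := by
      rw [Finset.sum_mul]
      exact Finset.sum_congr rfl fun q _ => by ring
    simp only [tensorAt, Matrix.of_apply, reduced_compl_singleton, glue_compl_singleton, pureState,
      hψg, hg, Function.update_self, Matrix.smul_apply, Matrix.vecMulVec_apply, Pi.star_apply,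
      smul_eq_mul, star_mul', h]
    field_simp [hN.ne']

/-- With `p` chosen so that every `f i (p i) ≠ 0`, evaluation at `p` is injective on `C`. -/
theorem finrank_le_one_of_factor {C : Submodule ℂ (Space a (Fin n))} {f : Fin n → Fin a → ℂ}
    (hf : ∀ i, f i ≠ 0) (hC : ∀ i, ∀ ψ ∈ C, ∃ g : (Fin n → Fin a) → ℂ,
      (∀ u p, g (Function.update u i p) = g u) ∧ ∀ u, ψ u = f i (u i) * g u) :
    Module.finrank ℂ C ≤ 1 := by
  choose p hp using fun i => Function.ne_iff.1 (hf i)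
  have key : ∀ ψ ∈ C, ψ p = 0 → ψ = 0 := by
    intro ψ hψ h0
    ext u
    by_contra hu
    -- Moving from `u` to `p` one coordinate at a time keeps the entry nonzero: `g` does not change
    -- and `f j (p j) ≠ 0`.
    have : ∀ S : Finset (Fin n), ψ (S.piecewise p u) ≠ 0 := by
      intro S
      induction S using Finset.induction_on with
      | empty => simpa using hu
      | insert j S _ ih =>
        obtain ⟨g, hg, hψg⟩ := hC j ψ hψ
        rw [hψg] at ih
        rw [Finset.piecewise_insert, hψg, hg, Function.update_self]
        exact mul_ne_zero (hp j) (right_ne_zero_of_mul ih)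
    exact this Finset.univ (by simpa using h0)
  let ev : C →ₗ[ℂ] ℂ :=
    { toFun := fun ψ => (ψ : Space a (Fin n)) p
      map_add' := fun _ _ => rfl
      map_smul' := fun _ _ => rfl }
  have hinj : Function.Injective ev :=
    (injective_iff_map_eq_zero ev).2 fun ψ h => Subtype.ext (key ψ ψ.2 h)
  simpa using LinearMap.finrank_le_finrank_of_injective hinj

end Qudit

theorem theorem8p1 {n a : ℕ} (ha : 1 ≤ a) (k : ℝ) (hk : 0 < k)
    (C : Submodule ℂ (Qudit.Space a (Fin n))) (hC : Qudit.HasCodeDimension C k) :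
    (∀ (i : Fin n) (I₁ I₂ : Finset (Fin n)), I₁ ∩ I₂ = {i} →
      Qudit.IsRecoverySet C i I₁ → Qudit.IsRecoverySet C i I₂ →
      ∃ α : Matrix (Fin a) (Fin a) ℂ, Qudit.IsDensityMatrix α ∧
        ∀ ψ ∈ C, ‖ψ‖ = 1 →
          Qudit.pureState ψ =
            Qudit.tensorAt i α (Qudit.reduced (Qudit.pureState ψ) {i}ᶜ)) ∧
    (2 ≤ a → ¬ ∀ i : Fin n, ∃ I₁ I₂ : Finset (Fin n), I₁ ∩ I₂ = {i} ∧
      Qudit.IsRecoverySet C i I₁ ∧ Qudit.IsRecoverySet C i I₂) := by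
  have hC0 : C ≠ ⊥ := by
    rintro rfl
    have h : (0 : ℝ) < (a : ℝ) ^ k := Real.rpow_pos_of_pos (by exact_mod_cast ha) k
    rw [← hC] at h
    simp at h
  refine ⟨fun i I₁ I₂ hI h₁ h₂ => ?_, fun ha2 h => ?_⟩
  · obtain ⟨f, hf, hfac⟩ := Qudit.exists_factor_of_recovery hC0 hI h₁ h₂
    obtain ⟨α, hα, h⟩ := Qudit.exists_densityMatrix_of_factor hf hfac
    exact ⟨α, hα, fun ψ hψ _ => h ψ hψ⟩
  · choose I₁ I₂ hI h₁ h₂ using h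
    choose f hf hfac using fun i => Qudit.exists_factor_of_recovery hC0 (hI i) (h₁ i) (h₂ i)
    have hle := Qudit.finrank_le_one_of_factor hf hfac
    have hlt : (1 : ℝ) < (a : ℝ) ^ k := Real.one_lt_rpow (by exact_mod_cast ha2) hk
    rw [← hC] at hlt
    exact absurd hle (not_le.2 (by exact_mod_cast hlt))
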